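/- Consider a deck of $4r$ cards with four suits and $r\ge 5$ ranks. The ranks are $0,1,\dots,r-1$, where $0$ is the ace, and the ace counts both as the lowest rank and as the rank $r$ directly above $r-1$. A straight consists of five cards whose ranks are $a,a+1,\dots,a+4$ in the sequence $0,1,\dots,r$ (with $r$ identified with the ace $0$). Use HC, 1P, 2P, 3X, ST, FL, FH, 4X, SF for high card, one pair, two pair, three of a kind, straight, flush, full house, four of a kind and straight flush. A seven-card hand contains the type $h$ if some five of its cards contain a poker hand of type $h$. Types are counted inclusively: for example, a full house contains 3X and 2P, four of a kind contains 3X and 2P (two disjoint pairs may have the same rank), a straight flush is both ST and FL, and every hand contains HC. Let $freq_r(h)$ be the number of seven-card hands containing $h$, and rank $h_0$ above $h_1$ exactly when $freq_r(h_0)<freq_r(h_1)$; write this as $h_0 > h_1$. Then the frequency ranking of the types 1P, 2P, 3X, ST, FL, FH, 4X, from rarest to most frequent, with all inequalities between frequencies strict, is: - $r=5$: FL > 4X > ST > FH > 3X > 2P > 1P; - $r=6$: FL > 4X > FH > 3X > ST > 2P > 1P; - $r=7$: 4X > FL > FH > 3X > ST > 2P > 1P; - $8\le r\le 12$: 4X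 > FL > FH > ST > 3X > 2P > 1P; - $13\le r\le 14$: 4X > FH > FL > ST > 3X > 2P > 1P; - $15\le r\le 18$: 4X > FH > ST > FL > 3X > 2P > 1P; - $19\le r\le 35$: 4X > FH > ST > 3X > FL > 2P > 1P; - $36\le r\le 306$: 4X > ST > FH > 3X > 2P > FL > 1P; - $307\le r\le 760$: 4X > ST > FH > 3X > 2P > 1P > FL; - $r\ge 761$: ST > 4X > FH > 3X > 2P > 1P > FL. Moreover SF ranks strictly above every other type for $r\ge 6$, while $freq_5(\mathrm{SF})=freq_5(\mathrm{FL})$; and HC ranks strictly below every other type for $r\ge 7$, while $freq_r(\mathrm{1P})=freq_r(\mathrm{HC})$ for $r=5,6$. In particular, the ranking of all nine hand types is the same for all $r\ge 761$, and $761$ is the least integer $N\ge 5$ such that the ranking is the same for all $r\ge N$. -/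

import Mathlib

namespace Poker

/-- The deck with `r` ranks and four suits. Rank `0` is the ace, which counts both as the lowest
rank and as the rank directly above `r - 1`. -/
abbrev Card (r : ℕ) : Type := Fin r × Fin 4

/-- The nine types of poker hand. -/
inductive HandType : Type
  | highCard
  | onePair
  | twoPair
  | threeOfAKind
  | straight
  | flush
  | fullHouse
  | fourOfAKind
  | straightFlush

/-- All cards of `t` have the same rank. -/
def SameRank {r : ℕ} (t : Finset (Card r)) : Prop :=
  ∀ c ∈ t, ∀ d ∈ t, c.1 = d.1

/-- `t` contains `k` cards of one rank. -/
def HasOfAKind {r : ℕ} (k : ℕ) (t : Finset (Card r)) : Prop :=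
  ∃ u ⊆ t, u.card = k ∧ SameRank u

/-- `t` contains two disjoint pairs. Their ranks may agree, so four of a kind contains a two-pair. -/
def HasTwoPair {r : ℕ} (t : Finset (Card r)) : Prop :=
  ∃ u ⊆ t, ∃ v ⊆ t, Disjoint u v ∧ u.card = 2 ∧ v.card = 2 ∧ SameRank u ∧ SameRank v

/-- `t` contains three cards of one rank and, disjointly, two cards of one rank. (As there are only
four suits, the two ranks are necessarily different.) -/
def HasFullHouse {r : ℕ} (t : Finset (Card r)) : Prop :=
  ∃ u ⊆ t, ∃ v ⊆ t, Disjoint u v ∧ u.card = 3 ∧ v.card = 2 ∧ SameRank u ∧ SameRank v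

/-- The ranks occurring in `t` are five consecutive ranks `a, a + 1, …, a + 4` in the sequence
`0, 1, …, r - 1, r`, where `0` and `r` both stand for the ace. -/
def IsStraight {r : ℕ} (t : Finset (Card r)) : Prop :=
  ∃ a : ℕ, a + 4 ≤ r ∧
    t.image (fun c => (c.1 : ℕ)) = (Finset.range 5).image (fun i => (a + i) % r)

/-- All cards of `t` have the same suit. -/
def IsFlush {r : ℕ} (t : Finset (Card r)) : Prop :=
  ∀ c ∈ t, ∀ d ∈ t, c.2 = d.2

/-- The five cards `t` contain a hand of the given type, counted inclusively. -/
def FiveContains {r : ℕ} (t : Finset (Card r)) : HandType → Prop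
  | .highCard => True
  | .onePair => HasOfAKind 2 t
  | .twoPair => HasTwoPair t
  | .threeOfAKind => HasOfAKind 3 t
  | .straight => IsStraight t
  | .flush => IsFlush t
  | .fullHouse => HasFullHouse t
  | .fourOfAKind => HasOfAKind 4 t
  | .straightFlush => IsStraight t ∧ IsFlush t

/-- `h ∈ s`: some five of the cards in `s` contain a hand of type `h`. -/
def Contains {r : ℕ} (s : Finset (Card r)) (h : HandType) : Prop :=
  ∃ t ⊆ s, t.card = 5 ∧ FiveContains t h

open Classical in
/-- The number of seven-card hands from the deck with `r` ranks that contain the hand type `h`. -/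
noncomputable def freq (r : ℕ) (h : HandType) : ℕ :=
  (((Finset.univ : Finset (Card r)).powersetCard 7).filter (fun s => Contains s h)).card

/-- `h₀` ranks above `h₁` in the frequency ranking when it is strictly rarer. -/
def RanksAbove (r : ℕ) (h₀ h₁ : HandType) : Prop :=
  freq r h₀ < freq r h₁

/-- `l` lists hand types strictly from highest-ranked (rarest) to lowest-ranked (most frequent). -/
def RankedAs (r : ℕ) (l : List HandType) : Prop :=
  l.Pairwise (RanksAbove r)

/-- The frequency rankings of all nine hand types for `r` and for `r'` ranks coincide. -/
def SameRanking (r r' : ℕ) : Prop :=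
  ∀ h₀ h₁ : HandType, RanksAbove r h₀ h₁ ↔ RanksAbove r' h₀ h₁

end Poker

/-!
Whether a seven-card hand contains a pair, two pair, three of a kind, a full house or four of a kind
depends only on how many cards it has of each rank, and whether it contains a straight depends only
on which ranks occur. Sorting the hands by their set of ranks therefore gives, for these types,
`freq = ∑ k, N k * weight k`, where `N k` is the number of admissible `k`-element rank sets and
`weight k` is the number of admissible ways to distribute seven cards over `k` given ranks
(`card_hands_eq_sum_weight`). The weights are a finite computation (`weight_eq_weightRow`). For
the types other than the straight, `N k` is a binomial coefficient; for the straight it is the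
number `runCount r k` of `k`-element rank sets containing a run of five. A set of at most seven
ranks is classified by the start of its first run, which gives
`runCount r k = (r - 5).choose (k - 5) + (r - 4) * (r - 6).choose (k - 5)` for `r ≥ 6`
(`runCount_eq`).

A flush or a straight flush depends on the ranks present within one suit, and seven cards have at
most one suit with five cards, so these types are counted suit by suit
(`card_hands_exists_suit`).

All frequencies are thus explicit polynomials in `r`. The types decided by the rank counts compare
term by term for every `r`. The remaining comparisons are evaluated for `r ≤ 760`; for `r ≥ 761`
the differences, written as polynomials in `r - 761`, have positive coefficients
(`freq_lt_of_le`).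
-/

namespace Poker

open Finset HandType

/-! ### Hand types in terms of rank counts -/

/-- The number of cards of rank `i` in the hand `s`. -/
def rankCount {r : ℕ} (s : Finset (Card r)) (i : Fin r) : ℕ := #{c ∈ s | c.1 = i}

/-- Some five of seven cards contain a set with property `p`, where such sets have at most five
elements, as soon as the seven cards do. -/
theorem exists_five_iff {r : ℕ} {s : Finset (Card r)} (hs : s.card = 7)
    {p : Finset (Card r) → Prop} (hp : ∀ u, p u → u.card ≤ 5)
    {P : Finset (Card r) → Prop} (hP : ∀ t, P t ↔ ∃ u ⊆ t, p u) :
    (∃ t ⊆ s, t.card = 5 ∧ P t) ↔ ∃ u ⊆ s, p u := by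
  constructor
  · rintro ⟨t, hts, -, ht⟩
    obtain ⟨u, hut, hu⟩ := (hP t).1 ht
    exact ⟨u, hut.trans hts, hu⟩
  · rintro ⟨u, hus, hu⟩
    obtain ⟨t, hut, hts, ht⟩ := exists_subsuperset_card_eq hus (hp u hu) (by omega)
    exact ⟨t, hts, ht, (hP t).2 ⟨u, hut, hu⟩⟩

theorem SameRank.exists_subset_filter {r : ℕ} {s u : Finset (Card r)} (hus : u ⊆ s)
    (hu : SameRank u) (h : 0 < u.card) : ∃ i, u ⊆ {c ∈ s | c.1 = i} := by
  obtain ⟨c, hc⟩ := card_pos.1 h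
  exact ⟨c.1, fun d hd => mem_filter.2 ⟨hus hd, hu d hd c hc⟩⟩

theorem sameRank_of_subset_filter {r : ℕ} {s u : Finset (Card r)} {i : Fin r}
    (h : u ⊆ {c ∈ s | c.1 = i}) : SameRank u := fun c hc d hd => by
  rw [(mem_filter.1 (h hc)).2, (mem_filter.1 (h hd)).2]

theorem hasOfAKind_iff {r k : ℕ} (hk : 0 < k) (s : Finset (Card r)) :
    HasOfAKind k s ↔ ∃ i, k ≤ rankCount s i := by
  constructor
  · rintro ⟨u, hus, rfl, hu⟩
    obtain ⟨i, hi⟩ := hu.exists_subset_filter hus hk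
    exact ⟨i, card_le_card hi⟩
  · rintro ⟨i, hi⟩
    obtain ⟨u, hu, huk⟩ := exists_subset_card_eq hi
    exact ⟨u, hu.trans (filter_subset _ _), huk, sameRank_of_subset_filter hu⟩

/-- Two disjoint sets of cards, each of one rank, use two ranks or share a single one. -/
theorem exists_disjoint_sameRank_iff {r a b : ℕ} (ha : 0 < a) (hb : 0 < b)
    (s : Finset (Card r)) :
    (∃ u ⊆ s, ∃ v ⊆ s, Disjoint u v ∧ u.card = a ∧ v.card = b ∧ SameRank u ∧ SameRank v) ↔
      (∃ i j, i ≠ j ∧ a ≤ rankCount s i ∧ b ≤ rankCount s j) ∨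
        ∃ i, a + b ≤ rankCount s i := by
  constructor
  · rintro ⟨u, hus, v, hvs, huv, rfl, rfl, hu, hv⟩
    obtain ⟨i, hi⟩ := hu.exists_subset_filter hus ha
    obtain ⟨j, hj⟩ := hv.exists_subset_filter hvs hb
    by_cases hij : i = j
    · subst hij
      refine .inr ⟨i, ?_⟩
      rw [← card_union_of_disjoint huv]
      exact card_le_card (union_subset hi hj)
    · exact .inl ⟨i, j, hij, card_le_card hi, card_le_card hj⟩
  · rintro (⟨i, j, hij, hi, hj⟩ | ⟨i, hi⟩)
    · obtain ⟨u, hu, huk⟩ := exists_subset_card_eq hi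
      obtain ⟨v, hv, hvk⟩ := exists_subset_card_eq hj
      refine ⟨u, hu.trans (filter_subset _ _), v, hv.trans (filter_subset _ _), ?_, huk, hvk,
        sameRank_of_subset_filter hu, sameRank_of_subset_filter hv⟩
      refine disjoint_left.2 fun c hcu hcv => hij ?_
      rw [← (mem_filter.1 (hu hcu)).2, ← (mem_filter.1 (hv hcv)).2]
    · obtain ⟨w, hw, hwk⟩ := exists_subset_card_eq hi
      obtain ⟨u, hu, huk⟩ := exists_subset_card_eq (s := w) (n := a) (by omega)
      refine ⟨u, (hu.trans hw).trans (filter_subset _ _), w \ u,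
        (sdiff_subset.trans hw).trans (filter_subset _ _), disjoint_sdiff, huk, ?_,
        sameRank_of_subset_filter (hu.trans hw),
        sameRank_of_subset_filter (sdiff_subset.trans hw)⟩
      rw [card_sdiff_of_subset hu]
      omega

theorem exists_five_disjoint_iff {r a b : ℕ} (ha : 0 < a) (hb : 0 < b) (hab : a + b ≤ 5)
    {s : Finset (Card r)} (hs : s.card = 7) :
    (∃ t ⊆ s, t.card = 5 ∧ ∃ u ⊆ t, ∃ v ⊆ t, Disjoint u v ∧ u.card = a ∧ v.card = b ∧
      SameRank u ∧ SameRank v) ↔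
      (∃ i j, i ≠ j ∧ a ≤ rankCount s i ∧ b ≤ rankCount s j) ∨
        ∃ i, a + b ≤ rankCount s i := by
  rw [← exists_disjoint_sameRank_iff ha hb]
  constructor
  · rintro ⟨t, hts, -, u, hu, v, hv, h⟩
    exact ⟨u, hu.trans hts, v, hv.trans hts, h⟩
  · rintro ⟨u, hu, v, hv, h⟩
    obtain ⟨t, hut, hts, ht⟩ := exists_subsuperset_card_eq (union_subset hu hv) (n := 5)
      (by have := card_union_le u v; omega) (by omega)
    exact ⟨t, hts, ht, u, union_subset_left hut, v, union_subset_right hut, h⟩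

theorem exists_five_hasOfAKind_iff {r k : ℕ} (hk : 0 < k) (hk5 : k ≤ 5)
    {s : Finset (Card r)} (hs : s.card = 7) :
    (∃ t ⊆ s, t.card = 5 ∧ HasOfAKind k t) ↔ ∃ i, k ≤ rankCount s i := by
  rw [← hasOfAKind_iff hk]
  refine exists_five_iff hs (p := fun u => u.card = k ∧ SameRank u) ?_ fun t => Iff.rfl
  rintro u ⟨rfl, -⟩
  exact hk5

theorem rankCount_le_four {r : ℕ} (s : Finset (Card r)) (i : Fin r) : rankCount s i ≤ 4 := by
  have h : #({c ∈ s | c.1 = i}.image Prod.snd) = rankCount s i :=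
    card_image_of_injOn fun c hc d hd h =>
      Prod.ext (by rw [(mem_filter.1 hc).2, (mem_filter.1 hd).2]) h
  rw [← h]
  simpa using card_le_univ ({c ∈ s | c.1 = i}.image Prod.snd)

/-- The condition on the rank counts `m` of a seven-card hand under which it contains the given
type, for the types that depend on the rank counts alone. There is no condition for the remaining
types, so that counting hands with a given rank set is the case `straight` of the same formulas. The
index type `ι` may be the set of all ranks or an enumeration of the ranks that occur. -/
def CountsContain {ι : Type} (m : ι → ℕ) : HandType → Prop
  | .onePair => ∃ i, 2 ≤ m i
  | .twoPair => (∃ i j, i ≠ j ∧ 2 ≤ m i ∧ 2 ≤ m j) ∨ ∃ i, 4 ≤ m i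
  | .threeOfAKind => ∃ i, 3 ≤ m i
  | .fullHouse => ∃ i j, i ≠ j ∧ 3 ≤ m i ∧ 2 ≤ m j
  | .fourOfAKind => ∃ i, 4 ≤ m i
  | _ => True

instance {ι : Type} [Fintype ι] [DecidableEq ι] (m : ι → ℕ) (h : HandType) :
    Decidable (CountsContain m h) := by
  cases h <;> unfold CountsContain <;> infer_instance

/-- The types decided by the rank counts of a hand. -/
def HandType.IsCount : HandType → Prop
  | .straight | .flush | .straightFlush => False
  | _ => True

theorem contains_iff_countsContain {r : ℕ} {s : Finset (Card r)} (hs : s.card = 7)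
    {h : HandType} (hh : h.IsCount) : Contains s h ↔ CountsContain (rankCount s) h := by
  cases h <;> simp only [HandType.IsCount] at hh
  case highCard =>
    obtain ⟨t, ht, htc⟩ := exists_subset_card_eq (s := s) (n := 5) (by omega)
    exact iff_of_true ⟨t, ht, htc, trivial⟩ trivial
  case onePair => exact exists_five_hasOfAKind_iff (by norm_num) (by norm_num) hs
  case twoPair => exact exists_five_disjoint_iff (by norm_num) (by norm_num) (by norm_num) hs
  case threeOfAKind => exact exists_five_hasOfAKind_iff (by norm_num) (by norm_num) hs
  case fullHouse =>
    refine (exists_five_disjoint_iff (by norm_num) (by norm_num) (by norm_num) hs).trans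
      (or_iff_left ?_)
    -- Five cards of one rank are excluded by the four suits.
    rintro ⟨i, hi⟩
    have := rankCount_le_four s i
    omega
  case fourOfAKind => exact exists_five_hasOfAKind_iff (by norm_num) (by norm_num) hs

/-- Ranks that do not occur in a hand are irrelevant to the types decided by rank counts. -/
theorem countsContain_comp_iff {ι κ : Type} {f : κ → ι} (hf : f.Injective) {m : ι → ℕ}
    (hm : ∀ i, m i ≠ 0 → ∃ k, f k = i) (h : HandType) :
    CountsContain (m ∘ f) h ↔ CountsContain m h := by
  have one : ∀ n, 0 < n → ((∃ k, n ≤ m (f k)) ↔ ∃ i, n ≤ m i) := by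
    refine fun n hn => ⟨fun ⟨k, hk⟩ => ⟨f k, hk⟩, fun ⟨i, hi⟩ => ?_⟩
    obtain ⟨k, rfl⟩ := hm i (by omega)
    exact ⟨k, hi⟩
  have two : ∀ a b, 0 < a → 0 < b → ((∃ k l, k ≠ l ∧ a ≤ m (f k) ∧ b ≤ m (f l)) ↔
      ∃ i j, i ≠ j ∧ a ≤ m i ∧ b ≤ m j) := by
    refine fun a b ha hb => ⟨fun ⟨k, l, hkl, h⟩ => ⟨f k, f l, hf.ne hkl, h⟩,
      fun ⟨i, j, hij, hi, hj⟩ => ?_⟩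
    obtain ⟨k, rfl⟩ := hm i (by omega)
    obtain ⟨l, rfl⟩ := hm j (by omega)
    exact ⟨k, l, fun h => hij (h ▸ rfl), hi, hj⟩
  cases h <;> simp only [CountsContain, Function.comp_apply]
  · exact one 2 (by norm_num)
  · exact or_congr (two 2 2 (by norm_num) (by norm_num)) (one 4 (by norm_num))
  · exact one 3 (by norm_num)
  · exact two 3 2 (by norm_num) (by norm_num)
  · exact one 4 (by norm_num)

/-! ### Counting hands by their set of ranks -/

/-- The number of seven-card hands that use exactly the `k` ranks of a given `k`-element set and
contain `h`. The sum runs over the possible rank counts `m`. -/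
def weight (k : ℕ) (h : HandType) : ℕ :=
  ∑ m ∈ (Nat.antidiagonalTuple k 7).filter (fun m => (∀ i, 1 ≤ m i) ∧ CountsContain m h),
    ∏ i, Nat.choose 4 (m i)

theorem card_suit_choices (k : ℕ) (h : HandType) :
    #{g : Fin k → Finset (Fin 4) | (∀ i, (g i).Nonempty) ∧ ∑ i, #(g i) = 7 ∧
      CountsContain (fun i => #(g i)) h} = weight k h := by
  rw [weight, card_eq_sum_card_fiberwise (f := fun g i => #(g i))
    (t := (Nat.antidiagonalTuple k 7).filter
      (fun m => (∀ i, 1 ≤ m i) ∧ CountsContain m h))]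
  · refine sum_congr rfl fun m hm => ?_
    have hm' := (mem_filter.1 hm)
    rw [Nat.mem_antidiagonalTuple] at hm'
    have : ∀ i, Nat.choose 4 (m i) = #(powersetCard (m i) (univ : Finset (Fin 4))) := by simp
    simp_rw [this]
    rw [← Fintype.card_piFinset]
    congr 1
    ext g
    simp only [mem_filter, mem_univ, true_and, Fintype.mem_piFinset, mem_powersetCard, subset_univ]
    constructor
    · rintro ⟨-, rfl⟩ i
      rfl
    · intro hg
      obtain rfl : (fun i => #(g i)) = m := funext hg
      exact ⟨⟨fun i => card_pos.1 (hm'.2.1 i), hm'.1, hm'.2.2⟩, rfl⟩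
  · intro g hg
    simp only [coe_filter, mem_univ, true_and, Set.mem_ofPred_eq] at hg
    simp only [coe_filter, Set.mem_ofPred_eq, Nat.mem_antidiagonalTuple]
    exact ⟨hg.2.1, fun i => card_pos.2 (hg.1 i), hg.2.2⟩

/-- The suits that occur at rank `i` are as many as the cards of rank `i`. -/
theorem card_suits_eq_rankCount {r : ℕ} (s : Finset (Card r)) (i : Fin r) :
    #{j | (i, j) ∈ s} = rankCount s i := by
  refine card_bij (fun j _ => (i, j)) ?_ ?_ ?_
  · intro j hj
    simpa using hj
  · intro j _ j' _ h
    simpa using h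
  · rintro ⟨i', j⟩ hc
    obtain ⟨hc, rfl⟩ := mem_filter.1 hc
    exact ⟨j, by simpa using hc, rfl⟩

theorem card_eq_sum_rankCount {r : ℕ} (s : Finset (Card r)) : s.card = ∑ i, rankCount s i :=
  card_eq_sum_card_fiberwise fun _ _ => mem_coe.2 (mem_univ _)

theorem rankCount_ne_zero_iff {r : ℕ} (s : Finset (Card r)) (i : Fin r) :
    rankCount s i ≠ 0 ↔ i ∈ s.image Prod.fst := by
  rw [rankCount, card_ne_zero, filter_nonempty_iff]
  simp

/-- A hand with rank set `S` is a choice of a nonempty set of suits for each rank in `S`, so the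
number of such hands depends on the size of `S` only. -/
theorem card_hands_of_ranks {r : ℕ} (S : Finset (Fin r)) (h : HandType) :
    #{s : Finset (Card r) | s.image Prod.fst = S ∧ s.card = 7 ∧
      CountsContain (rankCount s) h} = weight #S h := by
  rw [← card_suit_choices]
  set f := S.orderEmbOfFin rfl
  have hf : ∀ i, i ∈ S ↔ ∃ k, f k = i := fun i => by
    rw [← Set.mem_range, range_orderEmbOfFin, mem_coe]
  have hinj : Function.Injective f := f.injective
  -- Properties of a hand with rank set `S` seen through the ordered listing of `S`.
  have key : ∀ s : Finset (Card r), s.image Prod.fst = S →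
      (s.card = ∑ k, rankCount s (f k)) ∧
        (CountsContain (fun k => rankCount s (f k)) h ↔ CountsContain (rankCount s) h) := by
    intro s hs
    constructor
    · rw [card_eq_sum_rankCount, ← sum_subset (subset_univ S)]
      · rw [← sum_image (s := univ) (g := f) (f := rankCount s) hinj.injOn]
        refine sum_congr ?_ fun _ _ => rfl
        ext i
        simp [hf]
      · intro i _ hi
        by_contra h0
        exact hi (hs ▸ (rankCount_ne_zero_iff s i).1 h0)
    · refine countsContain_comp_iff (m := rankCount s) hinj (fun i hi => (hf i).1 ?_) h
      exact hs ▸ (rankCount_ne_zero_iff s i).1 hi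
  have hcnt : ∀ g : Fin #S → Finset (Fin 4), ∀ k,
      ({j | (f k, j) ∈ ({c | ∃ k, f k = c.1 ∧ c.2 ∈ g k} : Finset (Card r))} : Finset (Fin 4))
        = g k := by
    intro g k
    ext j
    simp [hinj.eq_iff]
  refine card_nbij' (fun s k => {j | (f k, j) ∈ s})
    (fun g => ({c | ∃ k, f k = c.1 ∧ c.2 ∈ g k} : Finset (Card r))) ?_ ?_ ?_ ?_
  · intro s hs
    obtain ⟨hS, h7, hc⟩ : s.image Prod.fst = S ∧ s.card = 7 ∧
      CountsContain (rankCount s) h := by simpa using hs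
    simp only [coe_filter, mem_univ, true_and, Set.mem_ofPred_eq, card_suits_eq_rankCount]
    refine ⟨fun k => card_pos.1 ?_, (key s hS).1 ▸ h7, (key s hS).2.2 hc⟩
    rw [card_suits_eq_rankCount, Nat.pos_iff_ne_zero, rankCount_ne_zero_iff, hS]
    exact (hf _).2 ⟨k, rfl⟩
  · intro g hg
    obtain ⟨hne, h7, hc⟩ : (∀ i, (g i).Nonempty) ∧ ∑ i, #(g i) = 7 ∧
      CountsContain (fun i => #(g i)) h := by simpa using hg
    set s : Finset (Card r) := {c | ∃ k, f k = c.1 ∧ c.2 ∈ g k} with hs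
    have hS : s.image Prod.fst = S := by
      ext i
      rw [hf]
      simp only [hs, mem_image, mem_filter, mem_univ, true_and, Prod.exists, exists_and_right,
        exists_eq_right]
      constructor
      · rintro ⟨j, k, hk, -⟩
        exact ⟨k, hk⟩
      · rintro ⟨k, hk⟩
        obtain ⟨j, hj⟩ := hne k
        exact ⟨j, k, hk, hj⟩
    have hk : ∀ k, rankCount s (f k) = #(g k) := fun k => by
      rw [← card_suits_eq_rankCount, hcnt g k]
    simp only [coe_filter, mem_univ, true_and, Set.mem_ofPred_eq]
    refine ⟨hS, ?_, ?_⟩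
    · rw [(key s hS).1]
      simpa only [hk] using h7
    · rw [← (key s hS).2]
      simpa only [hk] using hc
  · intro s hs
    have hS : s.image Prod.fst = S := by
      have := hs
      simp only [coe_filter, mem_univ, true_and, Set.mem_ofPred_eq] at this
      exact this.1
    ext ⟨i, j⟩
    simp only [mem_filter, mem_univ, true_and]
    constructor
    · rintro ⟨k, rfl, h⟩
      exact h
    · intro hij
      obtain ⟨k, rfl⟩ := (hf i).1 (hS ▸ mem_image_of_mem Prod.fst hij)
      exact ⟨k, rfl, hij⟩
  · intro g _
    exact funext (hcnt g)

open Classical in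
/-- Hands restricted by a condition `Q` on the set of ranks and by a type decided by the rank
counts are counted by the admissible rank sets of each size. -/
theorem card_hands_eq_sum_weight {r : ℕ} (Q : Finset (Fin r) → Prop) (h : HandType) :
    #{s ∈ powersetCard 7 (univ : Finset (Card r)) |
      Q (s.image Prod.fst) ∧ CountsContain (rankCount s) h} =
    ∑ k ∈ range 8, #{S ∈ powersetCard k (univ : Finset (Fin r)) | Q S} * weight k h := by
  rw [card_eq_sum_card_fiberwise (f := fun s => s.image Prod.fst)
    (t := univ.filter (fun S : Finset (Fin r) => #S < 8 ∧ Q S))]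
  · rw [← sum_fiberwise_of_maps_to (g := card) (t := range 8)]
    · refine sum_congr rfl fun k hk => ?_
      rw [← smul_eq_mul, ← sum_const]
      refine sum_congr ?_ fun S hS => ?_
      · ext S
        simp only [mem_filter, mem_univ, true_and, mem_powersetCard, subset_univ]
        constructor
        · rintro ⟨⟨-, hQ⟩, h⟩
          exact ⟨h, hQ⟩
        · rintro ⟨h, hQ⟩
          exact ⟨⟨h ▸ mem_range.1 hk, hQ⟩, h⟩
      · obtain ⟨hSk, hQ⟩ := mem_filter.1 hS
        rw [← (mem_powersetCard.1 hSk).2, ← card_hands_of_ranks]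
        congr 1
        ext s
        simp only [mem_filter, mem_univ, true_and, mem_powersetCard, subset_univ]
        constructor
        · rintro ⟨⟨h7, -, hc⟩, hs⟩
          exact ⟨hs, h7, hc⟩
        · rintro ⟨rfl, h7, hc⟩
          exact ⟨⟨h7, hQ, hc⟩, rfl⟩
    · intro S hS
      exact mem_range.2 (mem_filter.1 hS).2.1
  · intro s hs
    simp only [coe_filter, mem_powersetCard, subset_univ, true_and, Set.mem_ofPred_eq] at hs
    simp only [coe_filter, mem_univ, true_and, Set.mem_ofPred_eq]
    refine ⟨?_, hs.2.1⟩
    have := card_image_le (s := s) (f := Prod.fst)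
    omega

/-- The values of `weight`: entry `k` of the row of `h` is `weight k h`. -/
def weightRow : HandType → Fin 8 → ℕ
  | .onePair => ![0, 0, 8, 768, 8320, 28160, 36864, 0]
  | .twoPair => ![0, 0, 8, 768, 8320, 23040, 0, 0]
  | .threeOfAKind => ![0, 0, 8, 768, 4864, 5120, 0, 0]
  | .fullHouse => ![0, 0, 8, 768, 4608, 0, 0, 0]
  | .fourOfAKind => ![0, 0, 8, 144, 256, 0, 0, 0]
  | _ => ![0, 0, 8, 768, 8320, 28160, 36864, 16384]

/-- The sum defining `weight`, indexed by the excess of each rank count over `1`; it has few enough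
terms to be evaluated. -/
theorem weight_eq_sum_excess {k : ℕ} (hk : k ≤ 7) (h : HandType) :
    weight k h = ∑ m ∈ (Nat.antidiagonalTuple k (7 - k)).filter
      (fun m => CountsContain (fun i => m i + 1) h), ∏ i, Nat.choose 4 (m i + 1) := by
  have hsum : ∀ m : Fin k → ℕ, ∑ i, (m i + 1) = ∑ i, m i + k := fun m => by
    simp [sum_add_distrib]
  refine sum_nbij' (fun m i => m i - 1) (fun m i => m i + 1) ?_ ?_ ?_ ?_ ?_
  · intro m hm
    obtain ⟨h7, h1, hc⟩ := mem_filter.1 hm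
    rw [Nat.mem_antidiagonalTuple] at h7
    have hm1 : (fun i => m i - 1 + 1) = m := funext fun i => Nat.sub_add_cancel (h1 i)
    rw [mem_filter, Nat.mem_antidiagonalTuple, hm1]
    refine ⟨?_, hc⟩
    have := hsum fun i => m i - 1
    simp only [fun i => Nat.sub_add_cancel (h1 i), h7] at this
    omega
  · intro m hm
    obtain ⟨h7, hc⟩ := mem_filter.1 hm
    rw [Nat.mem_antidiagonalTuple] at h7
    rw [mem_filter, Nat.mem_antidiagonalTuple, hsum]
    exact ⟨by omega, fun i => Nat.le_add_left 1 _, hc⟩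
  · intro m hm
    exact funext fun i => Nat.sub_add_cancel ((mem_filter.1 hm).2.1 i)
  · intro m _
    rfl
  · intro m hm
    exact prod_congr rfl fun i _ => by rw [Nat.sub_add_cancel ((mem_filter.1 hm).2.1 i)]

theorem weight_eq_weightRow (h : HandType) (k : Fin 8) : weight k h = weightRow h k := by
  rw [weight_eq_sum_excess (by omega)]
  revert k
  cases h <;> decide +kernel

open Classical in
theorem freq_eq_sum_choose_mul_weight (r : ℕ) {h : HandType} (hh : h.IsCount) :
    freq r h = ∑ k : Fin 8, r.choose k * weightRow h k := by
  have := card_hands_eq_sum_weight (r := r) (fun _ => True) h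
  simp only [true_and, filter_true, card_powersetCard, card_univ, Fintype.card_fin] at this
  rw [← Fin.sum_univ_eq_sum_range (fun k => r.choose k * weight k h)] at this
  simp_rw [← weight_eq_weightRow]
  rw [← this, freq]
  congr 1
  refine filter_congr fun s hs => ?_
  exact contains_iff_countsContain (mem_powersetCard.1 hs).2 hh

theorem freq_highCard (r : ℕ) : freq r .highCard =
    8 * r.choose 2 + 768 * r.choose 3 + 8320 * r.choose 4 + 28160 * r.choose 5 +
      36864 * r.choose 6 + 16384 * r.choose 7 := by
  rw [freq_eq_sum_choose_mul_weight r (by trivial)]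
  simp [Fin.sum_univ_eight, weightRow, mul_comm]

theorem freq_onePair (r : ℕ) : freq r .onePair =
    8 * r.choose 2 + 768 * r.choose 3 + 8320 * r.choose 4 + 28160 * r.choose 5 +
      36864 * r.choose 6 := by
  rw [freq_eq_sum_choose_mul_weight r (by trivial)]
  simp [Fin.sum_univ_eight, weightRow, mul_comm]

theorem freq_twoPair (r : ℕ) : freq r .twoPair =
    8 * r.choose 2 + 768 * r.choose 3 + 8320 * r.choose 4 + 23040 * r.choose 5 := by
  rw [freq_eq_sum_choose_mul_weight r (by trivial)]
  simp [Fin.sum_univ_eight, weightRow, mul_comm]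

theorem freq_threeOfAKind (r : ℕ) : freq r .threeOfAKind =
    8 * r.choose 2 + 768 * r.choose 3 + 4864 * r.choose 4 + 5120 * r.choose 5 := by
  rw [freq_eq_sum_choose_mul_weight r (by trivial)]
  simp [Fin.sum_univ_eight, weightRow, mul_comm]

theorem freq_fullHouse (r : ℕ) : freq r .fullHouse =
    8 * r.choose 2 + 768 * r.choose 3 + 4608 * r.choose 4 := by
  rw [freq_eq_sum_choose_mul_weight r (by trivial)]
  simp [Fin.sum_univ_eight, weightRow, mul_comm]

theorem freq_fourOfAKind (r : ℕ) : freq r .fourOfAKind =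
    8 * r.choose 2 + 144 * r.choose 3 + 256 * r.choose 4 := by
  rw [freq_eq_sum_choose_mul_weight r (by trivial)]
  simp [Fin.sum_univ_eight, weightRow, mul_comm]

/-! ### Straights and flushes -/

/-- The set `S` of ranks contains the ranks of a straight. -/
def ContainsRun {r : ℕ} (S : Finset (Fin r)) : Prop :=
  ∃ a, a + 4 ≤ r ∧ ∀ i < 5, ∃ x ∈ S, (x : ℕ) = (a + i) % r

/-- Five consecutive residues modulo `r ≥ 5` are distinct. -/
theorem card_image_run {r : ℕ} (hr : 5 ≤ r) (a : ℕ) :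
    #((range 5).image fun i => (a + i) % r) = 5 := by
  rw [card_image_of_injOn, card_range]
  intro i hi j hj hij
  have hi' : i < 5 := by simpa using hi
  have hj' : j < 5 := by simpa using hj
  have : i ≡ j [MOD r] := Nat.ModEq.add_left_cancel' a hij
  exact Nat.ModEq.eq_of_lt_of_lt this (by omega) (by omega)

/-- A set of cards whose ranks contain a run contains five cards forming a straight. -/
theorem ContainsRun.exists_isStraight {r : ℕ} (hr : 5 ≤ r) {s : Finset (Card r)}
    (h : ContainsRun (s.image Prod.fst)) : ∃ t ⊆ s, #t = 5 ∧ IsStraight t := by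
  obtain ⟨a, ha, h⟩ := h
  have h' : ∀ i : Fin 5, ∃ c ∈ s, (c.1 : ℕ) = (a + i) % r := fun i => by
    obtain ⟨x, hx, hxa⟩ := h i i.2
    obtain ⟨c, hc, rfl⟩ := mem_image.1 hx
    exact ⟨c, hc, hxa⟩
  choose c hc hca using h'
  have himg : (univ.image c).image (fun c => (c.1 : ℕ)) =
      (range 5).image fun i => (a + i) % r := by
    ext x
    simp only [mem_image, mem_univ, true_and, exists_exists_eq_and, hca, mem_range]
    constructor
    · rintro ⟨i, rfl⟩
      exact ⟨i, i.2, rfl⟩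
    · rintro ⟨i, hi, rfl⟩
      exact ⟨⟨i, hi⟩, rfl⟩
  refine ⟨univ.image c, fun x hx => ?_, le_antisymm ?_ ?_, a, ha, himg⟩
  · obtain ⟨i, -, rfl⟩ := mem_image.1 hx
    exact hc i
  · simpa using card_image_le (s := univ) (f := c)
  · refine (card_image_run hr a).ge.trans ?_
    rw [← himg]
    exact card_image_le

theorem IsStraight.containsRun {r : ℕ} {t : Finset (Card r)} (h : IsStraight t) :
    ContainsRun (t.image Prod.fst) := by
  obtain ⟨a, ha, h⟩ := h
  refine ⟨a, ha, fun i hi => ?_⟩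
  have : (a + i) % r ∈ t.image (fun c => (c.1 : ℕ)) :=
    h ▸ mem_image_of_mem _ (mem_range.2 hi)
  obtain ⟨c, hc, hca⟩ := mem_image.1 this
  exact ⟨c.1, mem_image_of_mem _ hc, hca⟩

theorem ContainsRun.mono {r : ℕ} {S T : Finset (Fin r)} (hST : S ⊆ T) (h : ContainsRun S) :
    ContainsRun T := by
  obtain ⟨a, ha, h⟩ := h
  refine ⟨a, ha, fun i hi => ?_⟩
  obtain ⟨x, hx, hxa⟩ := h i hi
  exact ⟨x, hST hx, hxa⟩

theorem ContainsRun.five_le_card {r : ℕ} (hr : 5 ≤ r) {S : Finset (Fin r)}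
    (h : ContainsRun S) : 5 ≤ #S := by
  obtain ⟨a, -, h⟩ := h
  rw [← card_image_run hr a]
  calc _ ≤ #(S.image Fin.val) := card_le_card fun x hx => by
        obtain ⟨i, hi, rfl⟩ := mem_image.1 hx
        obtain ⟨x, hx, hxa⟩ := h i (mem_range.1 hi)
        exact mem_image.2 ⟨x, hx, hxa⟩
    _ ≤ _ := card_image_le

theorem contains_straight_iff {r : ℕ} (hr : 5 ≤ r) (s : Finset (Card r)) :
    Contains s .straight ↔ ContainsRun (s.image Prod.fst) :=
  ⟨fun ⟨_, hts, _, ht⟩ => IsStraight.containsRun ht |>.mono (image_subset_image hts),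
    fun h => h.exists_isStraight hr⟩

/-- The ranks of the cards of suit `j` in the hand `s`. -/
def suitRanks {r : ℕ} (s : Finset (Card r)) (j : Fin 4) : Finset (Fin r) := {i | (i, j) ∈ s}

theorem image_fst_filter_suit {r : ℕ} (s : Finset (Card r)) (j : Fin 4) :
    {c ∈ s | c.2 = j}.image Prod.fst = suitRanks s j := by
  ext i
  simp [suitRanks]

theorem card_filter_suit {r : ℕ} (s : Finset (Card r)) (j : Fin 4) :
    #{c ∈ s | c.2 = j} = #(suitRanks s j) := by
  rw [← image_fst_filter_suit, card_image_of_injOn]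
  exact fun c hc d hd h => Prod.ext h (by rw [(mem_filter.1 hc).2, (mem_filter.1 hd).2])

theorem IsFlush.exists_subset_filter {r : ℕ} {s t : Finset (Card r)} (hts : t ⊆ s)
    (ht : IsFlush t) (h : 0 < #t) : ∃ j, t ⊆ {c ∈ s | c.2 = j} := by
  obtain ⟨c, hc⟩ := card_pos.1 h
  exact ⟨c.2, fun d hd => mem_filter.2 ⟨hts hd, ht d hd c hc⟩⟩

theorem isFlush_of_subset_filter {r : ℕ} {s t : Finset (Card r)} {j : Fin 4}
    (h : t ⊆ {c ∈ s | c.2 = j}) : IsFlush t := fun c hc d hd => by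
  rw [(mem_filter.1 (h hc)).2, (mem_filter.1 (h hd)).2]

theorem contains_flush_iff {r : ℕ} (s : Finset (Card r)) :
    Contains s .flush ↔ ∃ j, 5 ≤ #(suitRanks s j) := by
  constructor
  · rintro ⟨t, hts, ht5, ht⟩
    obtain ⟨j, hj⟩ := IsFlush.exists_subset_filter hts ht (by omega)
    refine ⟨j, ?_⟩
    rw [← ht5, ← card_filter_suit]
    exact card_le_card hj
  · rintro ⟨j, hj⟩
    rw [← card_filter_suit] at hj
    obtain ⟨t, ht, ht5⟩ := exists_subset_card_eq hj
    exact ⟨t, ht.trans (filter_subset _ _), ht5, isFlush_of_subset_filter ht⟩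

theorem contains_straightFlush_iff {r : ℕ} (hr : 5 ≤ r) (s : Finset (Card r)) :
    Contains s .straightFlush ↔ ∃ j, ContainsRun (suitRanks s j) := by
  constructor
  · rintro ⟨t, hts, ht5, hst, hfl⟩
    obtain ⟨j, hj⟩ := IsFlush.exists_subset_filter hts hfl (by omega)
    refine ⟨j, hst.containsRun.mono ?_⟩
    rw [← image_fst_filter_suit]
    exact image_subset_image hj
  · rintro ⟨j, hj⟩
    rw [← image_fst_filter_suit] at hj
    obtain ⟨t, ht, ht5, hst⟩ := hj.exists_isStraight hr
    exact ⟨t, ht.trans (filter_subset _ _), ht5, hst, isFlush_of_subset_filter ht⟩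

/-! ### Counting by the ranks within one suit -/

/-- A set of size `n` with prescribed trace `A` on `B` amounts to a set of size `n - #A` outside
`B`. -/
theorem card_powersetCard_filter_inter_eq {α : Type*} [Fintype α] [DecidableEq α]
    {A B : Finset α} (hAB : A ⊆ B) {n : ℕ} (hn : #A ≤ n) :
    #{s ∈ powersetCard n (univ : Finset α) | s ∩ B = A} =
      (Fintype.card α - #B).choose (n - #A) := by
  rw [← card_compl, ← card_powersetCard]
  refine card_nbij' (fun s => s \ B) (fun s => s ∪ A) ?_ ?_ ?_ ?_
  · intro s hs
    simp only [coe_filter, mem_powersetCard, subset_univ, true_and, Set.mem_ofPred_eq] at hs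
    refine mem_coe.2 (mem_powersetCard.2 ⟨fun x hx => mem_compl.2 (mem_sdiff.1 hx).2, ?_⟩)
    have := card_sdiff_add_card_inter s B
    rw [hs.2] at this
    show #(s \ B) = n - #A
    omega
  · intro s hs
    obtain ⟨hsB, hsn⟩ := mem_powersetCard.1 (mem_coe.1 hs)
    have hd : Disjoint s B := (subset_compl_iff_disjoint_right).1 hsB
    simp only [coe_filter, mem_powersetCard, subset_univ, true_and, Set.mem_ofPred_eq]
    refine ⟨?_, ?_⟩
    · rw [card_union_of_disjoint (hd.mono_right hAB)]
      omega
    · rw [union_inter_distrib_right, disjoint_iff_inter_eq_empty.1 hd, empty_union,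
        inter_eq_left.2 hAB]
  · intro s hs
    obtain ⟨-, h⟩ := mem_filter.1 (mem_coe.1 hs)
    subst h
    exact sdiff_union_inter s B
  · intro s hs
    obtain ⟨hsB, hsn⟩ := mem_powersetCard.1 (mem_coe.1 hs)
    have hd : Disjoint s B := (subset_compl_iff_disjoint_right).1 hsB
    show (s ∪ A) \ B = s
    rw [union_sdiff_distrib, sdiff_eq_empty_iff_subset.2 hAB, union_empty]
    exact sdiff_eq_self_of_disjoint hd

theorem card_filter_suitRanks_eq {r : ℕ} (j : Fin 4) {T : Finset (Fin r)} (hT : #T ≤ 7) :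
    #{s ∈ powersetCard 7 (univ : Finset (Card r)) | suitRanks s j = T} =
      (3 * r).choose (7 - #T) := by
  have hinj : Function.Injective fun i : Fin r => ((i, j) : Card r) := fun i i' h => by
    simpa using h
  have hc : ∀ S : Finset (Fin r), #(S.image fun i => ((i, j) : Card r)) = #S := fun S =>
    card_image_of_injective S hinj
  have h := card_powersetCard_filter_inter_eq
    (image_subset_image (f := fun i : Fin r => ((i, j) : Card r)) (subset_univ T))
    (n := 7) (by rwa [hc])
  rw [hc, hc, card_univ, Fintype.card_prod, Fintype.card_fin, Fintype.card_fin,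
    show r * 4 - r = 3 * r by omega] at h
  rw [← h]
  congr 1
  refine filter_congr fun s _ => ?_
  simp only [Finset.ext_iff, suitRanks, mem_filter, mem_univ, true_and, mem_inter, mem_image,
    Prod.forall, Prod.mk.injEq]
  constructor
  · intro h i j'
    constructor
    · rintro ⟨hs, i, rfl, rfl⟩
      exact ⟨i, (h i).1 hs, rfl, rfl⟩
    · rintro ⟨i, hi, rfl, rfl⟩
      exact ⟨(h i).2 hi, i, rfl, rfl⟩
  · intro h i
    constructor
    · intro hi
      obtain ⟨i', hi', rfl, -⟩ := (h i j).1 ⟨hi, i, rfl, rfl⟩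
      exact hi'
    · intro hi
      exact ((h i j).2 ⟨i, hi, rfl, rfl⟩).1

open Classical in
/-- Seven cards hold at least five of one suit for at most one suit, so a condition on the ranks
within a suit that forces five ranks is counted suit by suit. -/
theorem card_hands_exists_suit {r : ℕ} {Q : Finset (Fin r) → Prop} (hQ : ∀ T, Q T → 5 ≤ #T) :
    #{s ∈ powersetCard 7 (univ : Finset (Card r)) | ∃ j, Q (suitRanks s j)} =
      4 * ∑ k ∈ Icc 5 7, #{T ∈ powersetCard k (univ : Finset (Fin r)) | Q T} *
        (3 * r).choose (7 - k) := by
  have hle : ∀ (s : Finset (Card r)) j, #(suitRanks s j) ≤ #s := fun s j =>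
    card_filter_suit s j ▸ card_filter_le _ _
  have hunion : {s ∈ powersetCard 7 (univ : Finset (Card r)) | ∃ j, Q (suitRanks s j)} =
      univ.biUnion fun j : Fin 4 =>
        {s ∈ powersetCard 7 (univ : Finset (Card r)) | Q (suitRanks s j)} := by
    ext s
    simp
  rw [hunion, card_biUnion]
  · rw [sum_congr rfl (g := fun _ => ∑ k ∈ Icc 5 7,
      #{T ∈ powersetCard k (univ : Finset (Fin r)) | Q T} * (3 * r).choose (7 - k))]
    · simp
    intro j _
    rw [card_eq_sum_card_fiberwise (f := fun s => suitRanks s j)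
      (t := univ.filter (fun T : Finset (Fin r) => #T ∈ Icc 5 7 ∧ Q T))]
    · rw [← sum_fiberwise_of_maps_to (g := card) (t := Icc 5 7)]
      · refine sum_congr rfl fun k hk => ?_
        rw [← smul_eq_mul, ← sum_const]
        refine sum_congr ?_ fun T hT => ?_
        · ext T
          simp only [mem_filter, mem_univ, true_and, mem_powersetCard, subset_univ]
          constructor
          · rintro ⟨⟨-, hQ⟩, h⟩
            exact ⟨h, hQ⟩
          · rintro ⟨h, hQ⟩
            exact ⟨⟨h ▸ hk, hQ⟩, h⟩
        · obtain ⟨hTk, hQT⟩ := mem_filter.1 hT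
          obtain rfl := (mem_powersetCard.1 hTk).2
          rw [← card_filter_suitRanks_eq j (mem_Icc.1 hk).2, filter_filter]
          congr 1
          refine filter_congr fun s _ => ?_
          exact ⟨fun h => h.2, fun h => ⟨h ▸ hQT, h⟩⟩
      · intro T hT
        exact (mem_filter.1 hT).2.1
    · intro s hs
      obtain ⟨hs7, hQs⟩ := mem_filter.1 (mem_coe.1 hs)
      have h7 := (mem_powersetCard.1 hs7).2
      refine mem_coe.2 (mem_filter.2 ⟨mem_univ _, mem_Icc.2 ⟨hQ _ hQs, ?_⟩, hQs⟩)
      exact h7 ▸ hle s j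
  · intro j _ j' _ hjj'
    refine disjoint_left.2 fun s hs hs' => ?_
    obtain ⟨hs7, hQs⟩ := mem_filter.1 hs
    obtain ⟨-, hQs'⟩ := mem_filter.1 hs'
    have h7 := (mem_powersetCard.1 hs7).2
    have h5 := hQ _ hQs
    have h5' := hQ _ hQs'
    rw [← card_filter_suit] at h5 h5'
    have hd : Disjoint {c ∈ s | c.2 = j} {c ∈ s | c.2 = j'} := by
      refine disjoint_left.2 fun c hc hc' => hjj' ?_
      rw [← (mem_filter.1 hc).2, ← (mem_filter.1 hc').2]
    have := card_le_card (union_subset (filter_subset (fun c => c.2 = j) s)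
      (filter_subset (fun c => c.2 = j') s))
    rw [card_union_of_disjoint hd] at this
    omega

/-! ### Counting rank sets that contain a run -/

open Classical in
/-- The number of `k`-element sets of ranks that contain the ranks of a straight. -/
noncomputable def runCount (r k : ℕ) : ℕ :=
  #{S ∈ powersetCard k (univ : Finset (Fin r)) | ContainsRun S}

theorem runCount_five_ranks (k : ℕ) : runCount 5 k = if k = 5 then 1 else 0 := by
  rw [runCount]
  have h : ∀ S : Finset (Fin 5), ContainsRun S ↔ S = univ := by
    intro S
    rw [← card_eq_iff_eq_univ, Fintype.card_fin]
    constructor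
    · intro h
      exact le_antisymm (by simpa using card_le_univ S) (h.five_le_card le_rfl)
    · intro h
      obtain rfl : S = univ := (card_eq_iff_eq_univ S).1 (by simpa using h)
      refine ⟨0, by norm_num, fun i hi => ⟨⟨i, hi⟩, mem_univ _, ?_⟩⟩
      simp [Nat.mod_eq_of_lt hi]
  simp only [h, filter_eq', mem_powersetCard, subset_univ, true_and, card_univ, Fintype.card_fin]
  by_cases hk : k = 5
  · simp [hk]
  · simp [hk, Ne.symm hk]

/-- The ranks `a, …, a + 4` of a straight, with the rank `r` identified with `0`. -/
def run (r a : ℕ) : Finset (Fin r) := {x | (x : ℕ) ∈ (range 5).image fun i => (a + i) % r}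

theorem mem_run {r a : ℕ} {x : Fin r} : x ∈ run r a ↔ ∃ i < 5, (x : ℕ) = (a + i) % r := by
  simp only [run, mem_filter, mem_univ, true_and, mem_image, mem_range, eq_comm]

theorem card_run {r : ℕ} (hr : 5 ≤ r) (a : ℕ) : #(run r a) = 5 := by
  rw [← card_image_run hr a, ← card_image_of_injective (run r a) Fin.val_injective]
  congr 1
  ext x
  simp only [mem_image, mem_run, mem_range]
  constructor
  · rintro ⟨y, ⟨i, hi, h⟩, rfl⟩
    exact ⟨i, hi, h.symm⟩
  · rintro ⟨i, hi, rfl⟩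
    exact ⟨⟨(a + i) % r, Nat.mod_lt _ (by omega)⟩, ⟨i, hi, rfl⟩, rfl⟩

theorem containsRun_iff {r : ℕ} (hr : 5 ≤ r) (S : Finset (Fin r)) :
    ContainsRun S ↔ ∃ a, a + 4 ≤ r ∧ run r a ⊆ S := by
  refine exists_congr fun a => and_congr_right fun _ => ?_
  constructor
  · intro h x hx
    obtain ⟨i, hi, hxi⟩ := mem_run.1 hx
    obtain ⟨y, hy, hyi⟩ := h i hi
    rwa [Fin.ext (hxi.trans hyi.symm)]
  · intro h i hi
    exact ⟨⟨(a + i) % r, Nat.mod_lt _ (by omega)⟩,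
      h (mem_run.2 ⟨i, hi, rfl⟩), rfl⟩

theorem mem_run_iff {r a : ℕ} (ha : a + 4 ≤ r) (x : Fin r) :
    x ∈ run r a ↔ (a ≤ x ∧ (x : ℕ) ≤ a + 4) ∨ (a + 4 = r ∧ (x : ℕ) = 0) := by
  have hx := x.2
  rw [mem_run]
  constructor
  · rintro ⟨i, hi, h⟩
    by_cases hai : a + i < r
    · rw [Nat.mod_eq_of_lt hai] at h
      omega
    · obtain rfl : i = 4 := by omega
      obtain h' : a + 4 = r := by omega
      rw [h', Nat.mod_self] at h
      omega
  · rintro (⟨h1, h2⟩ | ⟨h1, h2⟩)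
    · exact ⟨x - a, by omega, by rw [Nat.add_sub_cancel' h1, Nat.mod_eq_of_lt hx]⟩
    · exact ⟨4, by norm_num, by rw [h1, Nat.mod_self, h2]⟩

/-- If a set of at most seven ranks contains two runs, then the rank just below the higher run lies
in the set: the two runs have to overlap or touch. -/
theorem pred_mem_of_run_subset {r a b : ℕ} {S : Finset (Fin r)} (hS : #S ≤ 7) (hr : 6 ≤ r)
    (hb : b + 4 ≤ r) (hab : a < b) (ha : run r a ⊆ S) (hbS : run r b ⊆ S) :
    ⟨b - 1, by omega⟩ ∈ S := by
  by_cases h : b ≤ a + 5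
  · refine ha ((mem_run_iff (by omega) _).2 (.inl ?_))
    simp only
    omega
  · exfalso
    -- The runs share at most the ace, so together they would have nine ranks.
    have h1 : run r a ∩ run r b ⊆ {(⟨0, by omega⟩ : Fin r)} := by
      intro x hx
      have hx1 := (mem_run_iff (by omega) x).1 (mem_inter.1 hx).1
      have hx2 := (mem_run_iff hb x).1 (mem_inter.1 hx).2
      refine mem_singleton.2 (Fin.ext ?_)
      simp only
      omega
    have h2 := card_le_card h1
    have h3 := card_union_add_card_inter (run r a) (run r b)
    have h4 := card_le_card (union_subset ha hbS)
    rw [card_run (by omega), card_run (by omega)] at h3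
    rw [card_singleton] at h2
    omega

/-- A set of at most seven ranks containing a run is classified by the start `a` of its first run:
either `a = 0`, or the rank `a - 1` is missing. -/
theorem runCount_eq {r k : ℕ} (hr : 6 ≤ r) (hk5 : 5 ≤ k) (hk : k ≤ 7) :
    runCount r k = (r - 5).choose (k - 5) + (r - 4) * (r - 6).choose (k - 5) := by
  classical
  set U := powersetCard k (univ : Finset (Fin r)) with hU
  have hcard : ∀ S ∈ U, #S = k := fun S hS => (mem_powersetCard.1 hS).2
  set F0 : Finset (Finset (Fin r)) := {S ∈ U | S ∩ run r 0 = run r 0} with hF0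
  set F : Fin (r - 4) → Finset (Finset (Fin r)) := fun a =>
    {S ∈ U | S ∩ insert ⟨a, by omega⟩ (run r (a + 1)) = run r (a + 1)} with hF
  have hnot : ∀ a : Fin (r - 4), (⟨a, by omega⟩ : Fin r) ∉ run r (a + 1) := fun a h => by
    have := (mem_run_iff (by omega) _).1 h
    simp only at this
    omega
  have hF_iff : ∀ a S, S ∈ F a ↔ S ∈ U ∧ run r (a + 1) ⊆ S ∧ (⟨a, by omega⟩ : Fin r) ∉ S := by
    intro a S
    simp only [hF, mem_filter]
    refine and_congr_right fun _ => ?_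
    constructor
    · intro h
      refine ⟨inter_eq_right.1 ?_, fun ha => hnot a (h ▸ mem_inter.2 ⟨ha, mem_insert_self _ _⟩)⟩
      refine subset_antisymm inter_subset_right (subset_inter ?_ subset_rfl)
      exact h ▸ inter_subset_left
    · rintro ⟨h1, h2⟩
      rw [inter_insert_of_notMem h2, inter_eq_right.2 h1]
  have hF0_iff : ∀ S, S ∈ F0 ↔ S ∈ U ∧ run r 0 ⊆ S := fun S => by
    simp only [hF0, mem_filter, inter_eq_right]
  have hunion : U.filter ContainsRun = F0 ∪ univ.biUnion F := by
    ext S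
    simp only [mem_filter, mem_union, mem_biUnion, mem_univ, true_and, hF0_iff, hF_iff,
      containsRun_iff (show 5 ≤ r by omega)]
    constructor
    · rintro ⟨hSU, h⟩
      obtain ⟨b, ⟨hb, hbS⟩, hmin⟩ : ∃ b, (b + 4 ≤ r ∧ run r b ⊆ S) ∧
          ∀ a < b, ¬(a + 4 ≤ r ∧ run r a ⊆ S) :=
        ⟨Nat.find h, Nat.find_spec h, fun a ha => Nat.find_min h ha⟩
      cases b with
      | zero => exact .inl ⟨hSU, hbS⟩
      | succ b =>
        refine .inr ⟨⟨b, by omega⟩, hSU, hbS, fun hbmem => ?_⟩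
        -- With `b` in the set, a run would already start at `b`.
        refine hmin b (by omega) ⟨by omega, fun x hx => ?_⟩
        have hx' := (mem_run_iff (by omega) x).1 hx
        by_cases hxb : (x : ℕ) = b
        · rwa [show x = ⟨b, by omega⟩ from Fin.ext hxb]
        · exact hbS ((mem_run_iff hb x).2 (by omega))
    · rintro (⟨hSU, h⟩ | ⟨a, hSU, h, -⟩)
      · exact ⟨hSU, 0, by omega, h⟩
      · exact ⟨hSU, a + 1, by omega, h⟩
  have hle : ∀ S ∈ U, #S ≤ 7 := fun S hS => (hcard S hS).trans_le hk
  have hdisj0 : Disjoint F0 (univ.biUnion F) := by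
    refine disjoint_left.2 fun S h0 h1 => ?_
    obtain ⟨a, -, ha⟩ := mem_biUnion.1 h1
    obtain ⟨hSU, h0⟩ := (hF0_iff S).1 h0
    obtain ⟨-, ha, hna⟩ := (hF_iff a S).1 ha
    exact hna (pred_mem_of_run_subset (hle S hSU) hr (by omega) (by omega) h0 ha)
  have hlt : ∀ a b, a < b → Disjoint (F a) (F b) := by
    refine fun a b hab => disjoint_left.2 fun S ha hb => ?_
    obtain ⟨hSU, ha, -⟩ := (hF_iff a S).1 ha
    obtain ⟨-, hb, hnb⟩ := (hF_iff b S).1 hb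
    exact hnb (pred_mem_of_run_subset (hle S hSU) hr (by omega) (by omega) ha hb)
  have hdisj : ∀ a ∈ univ, ∀ b ∈ univ, a ≠ b → Disjoint (F a) (F b) := fun a _ b _ hab =>
    (lt_or_gt_of_ne hab).elim (hlt a b) fun h => (hlt b a h).symm
  have hcF0 : #F0 = (r - 5).choose (k - 5) := by
    rw [hF0, hU, card_powersetCard_filter_inter_eq subset_rfl (by rw [card_run] <;> omega),
      card_run (by omega), Fintype.card_fin]
  have hcF : ∀ a, #(F a) = (r - 6).choose (k - 5) := fun a => by
    rw [hF, hU, card_powersetCard_filter_inter_eq (subset_insert _ _)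
      (by rw [card_run] <;> omega), card_insert_of_notMem (hnot a), card_run (by omega),
      Fintype.card_fin]
  rw [runCount, ← hU]
  calc _ = #(F0 ∪ univ.biUnion F) := by
        rw [← hunion]
    _ = _ := by
        rw [card_union_of_disjoint hdisj0, card_biUnion hdisj, hcF0]
        simp [hcF]

/-! ### Frequencies of straights, flushes and straight flushes -/

theorem freq_straight {r : ℕ} (hr : 5 ≤ r) : freq r .straight =
    28160 * runCount r 5 + 36864 * runCount r 6 + 16384 * runCount r 7 := by
  classical
  have h := card_hands_eq_sum_weight (r := r) ContainsRun .straight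
  have hw : ∀ k, #{S ∈ powersetCard k (univ : Finset (Fin r)) | ContainsRun S} = runCount r k :=
    fun k => by rw [runCount]
  have hzero : ∀ k < 5, runCount r k = 0 := fun k hk => by
    rw [← hw, card_eq_zero, filter_eq_empty_iff]
    intro S hS hrun
    have := hrun.five_le_card hr
    rw [(mem_powersetCard.1 hS).2] at this
    omega
  simp_rw [hw] at h
  rw [← Fin.sum_univ_eq_sum_range (fun k => runCount r k * weight k .straight)] at h
  simp_rw [weight_eq_weightRow] at h
  simp only [Fin.sum_univ_eight, weightRow] at h
  simp [hzero] at h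
  rw [freq, mul_comm 28160, mul_comm 36864, mul_comm 16384, ← h]
  congr 1
  ext s
  simp only [mem_filter, contains_straight_iff hr, CountsContain, and_true]

theorem freq_straightFlush {r : ℕ} (hr : 5 ≤ r) : freq r .straightFlush =
    4 * (runCount r 5 * (3 * r).choose 2 + runCount r 6 * (3 * r) + runCount r 7) := by
  classical
  have h := card_hands_exists_suit (r := r) (Q := ContainsRun) fun T hT => hT.five_le_card hr
  have hw : ∀ k, #{S ∈ powersetCard k (univ : Finset (Fin r)) | ContainsRun S} = runCount r k :=
    fun k => by rw [runCount]
  simp_rw [hw] at h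
  rw [show Icc 5 7 = {5, 6, 7} from rfl] at h
  simp at h
  rw [freq, add_assoc, ← h]
  congr 1
  ext s
  simp only [mem_filter, contains_straightFlush_iff hr]

theorem freq_flush (r : ℕ) : freq r .flush =
    4 * (r.choose 5 * (3 * r).choose 2 + r.choose 6 * (3 * r) + r.choose 7) := by
  classical
  have h := card_hands_exists_suit (r := r) (Q := fun T => 5 ≤ #T) fun T hT => hT
  rw [sum_congr rfl (g := fun k => r.choose k * (3 * r).choose (7 - k)) fun k hk => ?_] at h
  · rw [show Icc 5 7 = {5, 6, 7} from rfl] at h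
    simp at h
    rw [freq, add_assoc, ← h]
    congr 1
    ext s
    simp only [mem_filter, contains_flush_iff]
  · congr 1
    trans #(powersetCard k (univ : Finset (Fin r)))
    · congr 1
      ext S
      simp only [mem_filter, and_iff_left_iff_imp]
      exact fun hS => (mem_powersetCard.1 hS).2 ▸ (mem_Icc.1 hk).1
    · simp

/-! ### Comparing frequencies -/

/-- The binomial coefficient as a quotient of a falling factorial, which takes `k` multiplications
to evaluate, unlike the recursion of `Nat.choose`. -/
def chooseEval (r k : ℕ) : ℕ := r.descFactorial k / k.factorial

/-- The frequency of `h` for `r ≥ 6` ranks, in evaluable form. -/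
def freqEval (r : ℕ) : HandType → ℕ
  | .straight => 28160 * (1 + (r - 4)) + 36864 * ((r - 5) + (r - 4) * (r - 6)) +
      16384 * (chooseEval (r - 5) 2 + (r - 4) * chooseEval (r - 6) 2)
  | .flush => 4 * (chooseEval r 5 * chooseEval (3 * r) 2 + chooseEval r 6 * (3 * r) +
      chooseEval r 7)
  | .straightFlush => 4 * ((1 + (r - 4)) * chooseEval (3 * r) 2 +
      ((r - 5) + (r - 4) * (r - 6)) * (3 * r) +
      (chooseEval (r - 5) 2 + (r - 4) * chooseEval (r - 6) 2))
  | h => ∑ k : Fin 8, chooseEval r k * weightRow h k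

theorem freq_eq_freqEval {r : ℕ} (hr : 6 ≤ r) (h : HandType) : freq r h = freqEval r h := by
  have hc : ∀ r k, chooseEval r k = r.choose k := fun r k =>
    (Nat.choose_eq_descFactorial_div_factorial r k).symm
  have h5 := runCount_eq hr (k := 5) le_rfl (by norm_num)
  have h6 := runCount_eq hr (k := 6) (by norm_num) (by norm_num)
  have h7 := runCount_eq hr (k := 7) (by norm_num) (by norm_num)
  norm_num at h5 h6 h7
  cases h
  case straight => simp only [freq_straight (by omega : 5 ≤ r), freqEval, h5, h6, h7, hc]
  case flush => simp only [freq_flush, freqEval, hc]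
  case straightFlush =>
    simp only [freq_straightFlush (by omega : 5 ≤ r), freqEval, h5, h6, h7, hc]
  all_goals
    rw [freq_eq_sum_choose_mul_weight r (by trivial)]
    simp only [freqEval, hc]

/-- Types decided by the rank counts are compared term by term in their expansions in binomial
coefficients. -/
theorem freq_counts_lt {r : ℕ} (hr : 5 ≤ r) :
    freq r fourOfAKind < freq r fullHouse ∧ freq r fullHouse < freq r threeOfAKind ∧
      freq r threeOfAKind < freq r twoPair ∧ freq r twoPair < freq r onePair ∧
      freq r onePair ≤ freq r highCard := by
  have h4 := Nat.choose_pos (show 4 ≤ r by omega)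
  have h5 := Nat.choose_pos hr
  rw [freq_fourOfAKind, freq_fullHouse, freq_threeOfAKind, freq_twoPair, freq_onePair,
    freq_highCard]
  omega

/-- The comparisons for large `r` that involve straights and flushes. After the shift
`r = n + 761` every difference of the two sides is a polynomial in `n` with positive
coefficients. -/
theorem freq_lt_of_le {r : ℕ} (hr : 761 ≤ r) :
    freq r straightFlush < freq r straight ∧ freq r straight < freq r fourOfAKind ∧
      freq r onePair < freq r flush ∧ freq r flush < freq r highCard := by
  obtain ⟨n, rfl⟩ := Nat.exists_eq_add_of_le' hr
  have hchoose : ∀ m k : ℕ, (m.choose k : ℚ) = (∏ j ∈ range k, (m - j : ℚ)) / k.factorial := by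
    intro m k
    rw [← descPochhammer_eval_eq_prod_range, descPochhammer_eval_eq_descFactorial,
      Nat.descFactorial_eq_factorial_mul_choose, Nat.cast_mul,
      mul_div_cancel_left₀ _ (by positivity)]
  have h5 := runCount_eq (r := n + 761) (k := 5) (by omega) le_rfl (by norm_num)
  have h6 := runCount_eq (r := n + 761) (k := 6) (by omega) (by norm_num) (by norm_num)
  have h7 := runCount_eq (r := n + 761) (k := 7) (by omega) (by norm_num) (by norm_num)
  rw [show n + 761 - 4 = n + 757 by omega, show n + 761 - 5 = n + 756 by omega,
    show n + 761 - 6 = n + 755 by omega] at h5 h6 h7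
  rw [freq_straightFlush (by omega), freq_straight (by omega), freq_fourOfAKind, freq_onePair,
    freq_flush, freq_highCard, h5, h6, h7]
  refine ⟨?_, ?_, ?_, ?_⟩
  all_goals
    rw [← Nat.cast_lt (α := ℚ)]
    push_cast
    simp only [hchoose, prod_range_succ, prod_range_zero, Nat.factorial]
    rw [← sub_pos]
    push_cast
    ring_nf
    clear hr h5 h6 h7
    positivity

/-! ### The rankings -/

instance (r : ℕ) : Trans (RanksAbove r) (RanksAbove r) (RanksAbove r) :=
  ⟨fun h h' => lt_trans h h'⟩

/-- The types in `l` are ranked as listed, all strictly between straight flush and high card. -/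
def RankedBetween (r : ℕ) (l : List HandType) : Prop :=
  RankedAs r (straightFlush :: l ++ [highCard])

theorem RankedBetween.rankedAs {r : ℕ} {l : List HandType} (h : RankedBetween r l) :
    RankedAs r l :=
  List.Pairwise.sublist ((List.sublist_append_left l _).trans (List.sublist_cons_self _ _)) h

theorem RankedBetween.straightFlush_above {r : ℕ} {l : List HandType} (h : RankedBetween r l)
    {t : HandType} (ht : t ∈ l ++ [highCard]) : RanksAbove r straightFlush t :=
  List.rel_of_pairwise_cons h ht

theorem RankedBetween.above_highCard {r : ℕ} {l : List HandType} (h : RankedBetween r l)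
    {t : HandType} (ht : t ∈ straightFlush :: l) : RanksAbove r t highCard :=
  (List.pairwise_append.1 h).2.2 t ht _ (List.mem_singleton_self _)

/-- `RankedBetween` follows from a comparison of the evaluable frequencies of neighbours. -/
theorem rankedBetween_of_isChain {r : ℕ} (hr : 6 ≤ r) {l : List HandType}
    (h : (straightFlush :: l ++ [highCard]).IsChain fun t t' => freqEval r t < freqEval r t') :
    RankedBetween r l := by
  refine List.isChain_iff_pairwise.1 (h.imp fun t t' htt' => ?_)
  rwa [RanksAbove, freq_eq_freqEval hr, freq_eq_freqEval hr]

theorem rankedBetween_seven : RankedBetween 7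
    [fourOfAKind, flush, fullHouse, threeOfAKind, straight, twoPair, onePair] :=
  rankedBetween_of_isChain (by norm_num) (by decide +kernel)

theorem rankedBetween_of_mem_Icc_8_12 : ∀ r ∈ Icc 8 12, RankedBetween r
    [fourOfAKind, flush, fullHouse, straight, threeOfAKind, twoPair, onePair] := by
  have h : ∀ r < 13, 8 ≤ r → (straightFlush ::
      [fourOfAKind, flush, fullHouse, straight, threeOfAKind, twoPair, onePair] ++
      [highCard]).IsChain fun t t' => freqEval r t < freqEval r t' := by decide +kernel
  intro r hr
  rw [mem_Icc] at hr
  exact rankedBetween_of_isChain (by omega) (h r (by omega) hr.1)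

theorem rankedBetween_of_mem_Icc_13_14 : ∀ r ∈ Icc 13 14, RankedBetween r
    [fourOfAKind, fullHouse, flush, straight, threeOfAKind, twoPair, onePair] := by
  have h : ∀ r < 15, 13 ≤ r → (straightFlush ::
      [fourOfAKind, fullHouse, flush, straight, threeOfAKind, twoPair, onePair] ++
      [highCard]).IsChain fun t t' => freqEval r t < freqEval r t' := by decide +kernel
  intro r hr
  rw [mem_Icc] at hr
  exact rankedBetween_of_isChain (by omega) (h r (by omega) hr.1)

theorem rankedBetween_of_mem_Icc_15_18 : ∀ r ∈ Icc 15 18, RankedBetween r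
    [fourOfAKind, fullHouse, straight, flush, threeOfAKind, twoPair, onePair] := by
  have h : ∀ r < 19, 15 ≤ r → (straightFlush ::
      [fourOfAKind, fullHouse, straight, flush, threeOfAKind, twoPair, onePair] ++
      [highCard]).IsChain fun t t' => freqEval r t < freqEval r t' := by decide +kernel
  intro r hr
  rw [mem_Icc] at hr
  exact rankedBetween_of_isChain (by omega) (h r (by omega) hr.1)

theorem rankedBetween_of_mem_Icc_19_35 : ∀ r ∈ Icc 19 35, RankedBetween r
    [fourOfAKind, fullHouse, straight, threeOfAKind, flush, twoPair, onePair] := by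
  have h : ∀ r < 36, 19 ≤ r → (straightFlush ::
      [fourOfAKind, fullHouse, straight, threeOfAKind, flush, twoPair, onePair] ++
      [highCard]).IsChain fun t t' => freqEval r t < freqEval r t' := by decide +kernel
  intro r hr
  rw [mem_Icc] at hr
  exact rankedBetween_of_isChain (by omega) (h r (by omega) hr.1)

theorem rankedBetween_of_mem_Icc_36_306 : ∀ r ∈ Icc 36 306, RankedBetween r
    [fourOfAKind, straight, fullHouse, threeOfAKind, twoPair, flush, onePair] := by
  have h : ∀ r < 307, 36 ≤ r → (straightFlush ::
      [fourOfAKind, straight, fullHouse, threeOfAKind, twoPair, flush, onePair] ++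
      [highCard]).IsChain fun t t' => freqEval r t < freqEval r t' := by decide +kernel
  intro r hr
  rw [mem_Icc] at hr
  exact rankedBetween_of_isChain (by omega) (h r (by omega) hr.1)

theorem rankedBetween_of_mem_Icc_307_760 : ∀ r ∈ Icc 307 760, RankedBetween r
    [fourOfAKind, straight, fullHouse, threeOfAKind, twoPair, onePair, flush] := by
  have h : ∀ r < 761, 307 ≤ r → (straightFlush ::
      [fourOfAKind, straight, fullHouse, threeOfAKind, twoPair, onePair, flush] ++
      [highCard]).IsChain fun t t' => freqEval r t < freqEval r t' := by decide +kernel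
  intro r hr
  rw [mem_Icc] at hr
  exact rankedBetween_of_isChain (by omega) (h r (by omega) hr.1)

theorem rankedBetween_of_le {r : ℕ} (hr : 761 ≤ r) : RankedBetween r
    [straight, fourOfAKind, fullHouse, threeOfAKind, twoPair, onePair, flush] := by
  obtain ⟨h1, h2, h3, h4⟩ := freq_lt_of_le hr
  obtain ⟨h5, h6, h7, h8, -⟩ := freq_counts_lt (show 5 ≤ r by omega)
  refine List.isChain_iff_pairwise.1 ?_
  simp only [List.cons_append, List.nil_append, List.isChain_cons_cons, List.isChain_singleton,
    RanksAbove]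
  exact ⟨h1, h2, h5, h6, h7, h8, h3, h4, trivial⟩

theorem exists_rankedBetween {r : ℕ} (hr : 7 ≤ r) :
    ∃ l, RankedBetween r l ∧ ∀ t, t = straightFlush ∨ t ∈ l ∨ t = highCard := by
  have hcases : r = 7 ∨ r ∈ Icc 8 12 ∨ r ∈ Icc 13 14 ∨ r ∈ Icc 15 18 ∨ r ∈ Icc 19 35 ∨
      r ∈ Icc 36 306 ∨ r ∈ Icc 307 760 ∨ 761 ≤ r := by
    simp only [mem_Icc]
    omega
  rcases hcases with rfl | h | h | h | h | h | h | h
  · exact ⟨_, rankedBetween_seven, fun t => by cases t <;> simp⟩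
  · exact ⟨_, rankedBetween_of_mem_Icc_8_12 r h, fun t => by cases t <;> simp⟩
  · exact ⟨_, rankedBetween_of_mem_Icc_13_14 r h, fun t => by cases t <;> simp⟩
  · exact ⟨_, rankedBetween_of_mem_Icc_15_18 r h, fun t => by cases t <;> simp⟩
  · exact ⟨_, rankedBetween_of_mem_Icc_19_35 r h, fun t => by cases t <;> simp⟩
  · exact ⟨_, rankedBetween_of_mem_Icc_36_306 r h, fun t => by cases t <;> simp⟩
  · exact ⟨_, rankedBetween_of_mem_Icc_307_760 r h, fun t => by cases t <;> simp⟩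
  · exact ⟨_, rankedBetween_of_le h, fun t => by cases t <;> simp⟩

/-- With six ranks there are no seven different ones, so high card ties with one pair and only the
first eight types are strictly ranked. -/
theorem rankedAs_six : RankedAs 6 (straightFlush ::
    [flush, fourOfAKind, fullHouse, threeOfAKind, straight, twoPair, onePair]) := by
  have h : (straightFlush ::
      [flush, fourOfAKind, fullHouse, threeOfAKind, straight, twoPair, onePair]).IsChain
      fun t t' => freqEval 6 t < freqEval 6 t' := by decide +kernel
  refine List.isChain_iff_pairwise.1 (h.imp fun t t' htt' => ?_)
  rwa [RanksAbove, freq_eq_freqEval le_rfl, freq_eq_freqEval le_rfl]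

theorem rankedAs_five : RankedAs 5
    [flush, fourOfAKind, straight, fullHouse, threeOfAKind, twoPair, onePair] := by
  refine List.isChain_iff_pairwise.1 ?_
  simp only [List.isChain_cons_cons, List.isChain_singleton, RanksAbove, freq_flush,
    freq_fourOfAKind, freq_straight le_rfl, freq_fullHouse, freq_threeOfAKind, freq_twoPair,
    freq_onePair, runCount_five_ranks]
  decide +kernel

/-- A strict ranking of all nine types determines every comparison. -/
theorem RankedBetween.sameRanking {r r' : ℕ} {l : List HandType} (h : RankedBetween r l)
    (h' : RankedBetween r' l) (hl : ∀ t, t = straightFlush ∨ t ∈ l ∨ t = highCard) :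
    SameRanking r r' := by
  -- In a strictly ranked list any two distinct members are comparable, in the same way for both.
  have key : ∀ t₀ t₁, t₀ ≠ t₁ → (RanksAbove r t₀ t₁ ∧ RanksAbove r' t₀ t₁) ∨
      (RanksAbove r t₁ t₀ ∧ RanksAbove r' t₁ t₀) := by
    have hmem : ∀ t, t ∈ straightFlush :: l ++ [highCard] := fun t => by
      simpa [or_assoc] using hl t
    have hp : (straightFlush :: l ++ [highCard]).Pairwise fun t₀ t₁ =>
        (RanksAbove r t₀ t₁ ∧ RanksAbove r' t₀ t₁) ∨
          (RanksAbove r t₁ t₀ ∧ RanksAbove r' t₁ t₀) :=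
      (List.Pairwise.and h h').imp .inl
    have : Std.Symm fun t₀ t₁ => (RanksAbove r t₀ t₁ ∧ RanksAbove r' t₀ t₁) ∨
        (RanksAbove r t₁ t₀ ∧ RanksAbove r' t₁ t₀) := ⟨fun _ _ h => h.symm⟩
    exact fun t₀ t₁ hne => hp.forall (hmem t₀) (hmem t₁) hne
  intro t₀ t₁
  by_cases hne : t₀ = t₁
  · subst hne
    simp [RanksAbove]
  · have := key t₀ t₁ hne
    simp only [RanksAbove] at this ⊢
    omega

end Poker

open Poker HandType in
theorem fact3 :
    -- the seven hand types between straight flush and high card, for each range of `r ≥ 5`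
    RankedAs 5
      [flush, fourOfAKind, straight, fullHouse, threeOfAKind, twoPair, onePair] ∧
    RankedAs 6
      [flush, fourOfAKind, fullHouse, threeOfAKind, straight, twoPair, onePair] ∧
    RankedAs 7
      [fourOfAKind, flush, fullHouse, threeOfAKind, straight, twoPair, onePair] ∧
    (∀ r : ℕ, 8 ≤ r → r ≤ 12 → RankedAs r
      [fourOfAKind, flush, fullHouse, straight, threeOfAKind, twoPair, onePair]) ∧
    (∀ r : ℕ, 13 ≤ r → r ≤ 14 → RankedAs r
      [fourOfAKind, fullHouse, flush, straight, threeOfAKind, twoPair, onePair]) ∧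
    (∀ r : ℕ, 15 ≤ r → r ≤ 18 → RankedAs r
      [fourOfAKind, fullHouse, straight, flush, threeOfAKind, twoPair, onePair]) ∧
    (∀ r : ℕ, 19 ≤ r → r ≤ 35 → RankedAs r
      [fourOfAKind, fullHouse, straight, threeOfAKind, flush, twoPair, onePair]) ∧
    (∀ r : ℕ, 36 ≤ r → r ≤ 306 → RankedAs r
      [fourOfAKind, straight, fullHouse, threeOfAKind, twoPair, flush, onePair]) ∧
    (∀ r : ℕ, 307 ≤ r → r ≤ 760 → RankedAs r
      [fourOfAKind, straight, fullHouse, threeOfAKind, twoPair, onePair, flush]) ∧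
    (∀ r : ℕ, 761 ≤ r → RankedAs r
      [straight, fourOfAKind, fullHouse, threeOfAKind, twoPair, onePair, flush]) ∧
    -- straight flush ranks highest and high card ranks lowest, with the only ties listed
    (∀ r : ℕ, 6 ≤ r → ∀ h : HandType, h ≠ straightFlush → RanksAbove r straightFlush h) ∧
    freq 5 straightFlush = freq 5 flush ∧
    (∀ r : ℕ, 7 ≤ r → ∀ h : HandType, h ≠ highCard → RanksAbove r h highCard) ∧
    freq 5 onePair = freq 5 highCard ∧
    freq 6 onePair = freq 6 highCard ∧
    -- the complete ranking is stable from `r = 761` on, and from no earlier `r`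
    IsLeast {N : ℕ | 5 ≤ N ∧ ∀ r : ℕ, N ≤ r → SameRanking N r} 761 := by
  refine ⟨rankedAs_five, List.Pairwise.of_cons rankedAs_six, rankedBetween_seven.rankedAs,
    fun r h h' => (rankedBetween_of_mem_Icc_8_12 r (Finset.mem_Icc.2 ⟨h, h'⟩)).rankedAs,
    fun r h h' => (rankedBetween_of_mem_Icc_13_14 r (Finset.mem_Icc.2 ⟨h, h'⟩)).rankedAs,
    fun r h h' => (rankedBetween_of_mem_Icc_15_18 r (Finset.mem_Icc.2 ⟨h, h'⟩)).rankedAs,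
    fun r h h' => (rankedBetween_of_mem_Icc_19_35 r (Finset.mem_Icc.2 ⟨h, h'⟩)).rankedAs,
    fun r h h' => (rankedBetween_of_mem_Icc_36_306 r (Finset.mem_Icc.2 ⟨h, h'⟩)).rankedAs,
    fun r h h' => (rankedBetween_of_mem_Icc_307_760 r (Finset.mem_Icc.2 ⟨h, h'⟩)).rankedAs,
    fun r h => (rankedBetween_of_le h).rankedAs, ?_, ?_, ?_, ?_, ?_, ⟨by norm_num, ?_⟩, ?_⟩
  · intro r hr h hh
    obtain rfl | hr := hr.eq_or_lt
    · have above : ∀ t ∈ [flush, fourOfAKind, fullHouse, threeOfAKind, straight, twoPair,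
          onePair], RanksAbove 6 straightFlush t :=
        fun t ht => List.rel_of_pairwise_cons rankedAs_six ht
      cases h with
      | straightFlush => exact absurd rfl hh
      | highCard =>
        exact (above onePair (by simp)).trans_le (freq_counts_lt (r := 6) (by norm_num)).2.2.2.2
      | _ => exact above _ (by simp)
    · obtain ⟨l, hl, hall⟩ := exists_rankedBetween hr
      exact hl.straightFlush_above (by simpa [hh] using hall h)
  · rw [freq_straightFlush le_rfl, freq_flush]
    simp [runCount_five_ranks, Nat.choose]
  · intro r hr h hh
    obtain ⟨l, hl, hall⟩ := exists_rankedBetween hr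
    exact hl.above_highCard (by simpa [hh] using hall h)
  · rw [freq_onePair, freq_highCard]
    simp [Nat.choose]
  · rw [freq_onePair, freq_highCard]
    simp [Nat.choose]
  · intro r hr
    exact (rankedBetween_of_le le_rfl).sameRanking (rankedBetween_of_le hr)
      fun t => by cases t <;> simp
  · rintro N ⟨-, hN⟩
    by_contra! hlt
    -- Between `760` and `761` straight and four of a kind change places.
    have h760 : RanksAbove 760 fourOfAKind straight :=
      List.rel_of_pairwise_cons
        (rankedBetween_of_mem_Icc_307_760 760 (by simp)).rankedAs (by simp)
    have h761 : RanksAbove 761 straight fourOfAKind :=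
      List.rel_of_pairwise_cons (rankedBetween_of_le le_rfl).rankedAs (by simp)
    have h := (hN 761 (by omega) fourOfAKind straight).1
      ((hN 760 (by omega) fourOfAKind straight).2 h760)
    exact lt_asymm h h761
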